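/- Let $G=(V,E)$ be a finite connected simple graph with $n\ge 1$ vertices $v_1,\dots,v_n$, and let $k\ge 2$ be an integer. Let $(\Lambda V_{G,k},d)$ be the pure Sullivan algebra over $\mathbb{Q}$ (the free graded commutative algebra with a differential) with generators $x_1,\dots,x_n$ of degree $2$ and one generator $y_{r,s}$ of degree $2k-3$ for each edge $\{v_r,v_s\}$ of $G$, where $$d x_i=0,\qquad d y_{r,s}=\sum_{l=1}^{k}x_r^{k-l}x_s^{l-1}.$$ Put $$d'_{n,k}=\left\lceil\frac{n(n-1)(2k-3)-n}{2}\right\rceil ,$$ and let $(\Lambda W_{G,k},d)$ be the extension of $(\Lambda V_{G,k},d)$ by further generators $z_1,\dots,z_n$ of degree $4(d'_{n,k}+n)+3$ with $d z_i=x_i^{2(d'_{n,k}+n+1)}$. The cup-length of such an algebra $(A,d)$ is the supremum in $\mathbb{N}_0\cup\{\infty\}$ of the numbers $m$ for which there are classes $c_1,\dots,c_m\in H^{>0}(A,d)$ with $c_1\cdots c_m\neq 0$, and $(\Lambda V,d)$ is called elliptic if both $V$ and $H(\Lambda V,d)$ are finite-dimensional over $\mathbb{Q}$. Then the following two statements are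 equivalent: (i) the cup-length of $(\Lambda W_{G,k},d)$ is at most $d'_{n,k}+n$; (ii) the Sullivan algebra $(\Lambda V_{G,k},d)$ is elliptic. -/

import Mathlib

/-- A pure Sullivan algebra `(ΛV, d)` over `ℚ`, given by homogeneous bases of `V^even` and `V^odd`
(indexed by `EvenGen` and `OddGen`) with positive degrees, where `d` vanishes on `V^even` and maps
`V^odd` into `ΛV^even = ℚ[V^even]`, raising the degree by one. -/
structure PureSullivanAlgebra.{u} where
  EvenGen : Type u
  OddGen : Type u
  evenDeg : EvenGen → ℕ
  oddDeg : OddGen → ℕ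
  evenDeg_pos : ∀ i, 0 < evenDeg i
  even_evenDeg : ∀ i, Even (evenDeg i)
  odd_oddDeg : ∀ j, Odd (oddDeg j)
  dOdd : OddGen → MvPolynomial EvenGen ℚ
  dOdd_homogeneous : ∀ j, (dOdd j).IsWeightedHomogeneous evenDeg (oddDeg j + 1)

namespace PureSullivanAlgebra

universe u

/-- `ΛV^even`, the polynomial algebra on the even generators. -/
abbrev EvenAlg (P : PureSullivanAlgebra.{u}) : Type u := MvPolynomial P.EvenGen ℚ

/-- `ΛV = ℚ[V^even] ⊗ Λ(V^odd)`, the free graded commutative algebra on `V`, realised as the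
exterior algebra over `ℚ[V^even]` of the free module on the odd generators. -/
abbrev Alg (P : PureSullivanAlgebra.{u}) : Type u :=
  ExteriorAlgebra P.EvenAlg (P.OddGen →₀ P.EvenAlg)

/-- The generator of `ΛV` given by a basis element of `V^even`. -/
noncomputable def evenGen (P : PureSullivanAlgebra.{u}) (i : P.EvenGen) : P.Alg :=
  algebraMap P.EvenAlg P.Alg (MvPolynomial.X i)

/-- The generator of `ΛV` given by a basis element of `V^odd`. -/
noncomputable def oddGen (P : PureSullivanAlgebra.{u}) (j : P.OddGen) : P.Alg :=
  ExteriorAlgebra.ι P.EvenAlg (Finsupp.single j 1)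

/-- The `ℚ[V^even]`-linear form on the free module on the odd generators with `y ↦ d y`. -/
noncomputable def dForm (P : PureSullivanAlgebra.{u}) :
    Module.Dual P.EvenAlg (P.OddGen →₀ P.EvenAlg) :=
  Finsupp.linearCombination P.EvenAlg P.dOdd

/-- The differential of `ΛV`: the unique graded derivation that vanishes on the even generators
and takes the prescribed values on the odd ones. -/
noncomputable def differential (P : PureSullivanAlgebra.{u}) : P.Alg →ₗ[P.EvenAlg] P.Alg :=
  CliffordAlgebra.contractLeft P.dForm

theorem differential_algebraMap (P : PureSullivanAlgebra.{u}) (p : P.EvenAlg) :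
    P.differential (algebraMap P.EvenAlg P.Alg p) = 0 :=
  CliffordAlgebra.contractLeft_algebraMap _ _ _

theorem differential_evenGen (P : PureSullivanAlgebra.{u}) (i : P.EvenGen) :
    P.differential (P.evenGen i) = 0 :=
  P.differential_algebraMap _

theorem differential_oddGen (P : PureSullivanAlgebra.{u}) (j : P.OddGen) :
    P.differential (P.oddGen j) = algebraMap P.EvenAlg P.Alg (P.dOdd j) := by
  refine (CliffordAlgebra.contractLeft_ι _ _ _).trans ?_
  simp [dForm]

theorem differential_differential (P : PureSullivanAlgebra.{u}) (a : P.Alg) :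
    P.differential (P.differential a) = 0 :=
  CliffordAlgebra.contractLeft_contractLeft _ _

/-- The graded Leibniz rule; `involute` is multiplication by `(-1) ^ |a|` on homogeneous `a`. -/
theorem differential_mul (P : PureSullivanAlgebra.{u}) (a b : P.Alg) :
    P.differential (a * b) =
      P.differential a * b + CliffordAlgebra.involute a * P.differential b := by
  induction a using CliffordAlgebra.left_induction with
  | algebraMap r =>
    simp [differential, CliffordAlgebra.contractLeft_algebraMap_mul]
  | add x y hx hy =>
    simp only [add_mul, map_add, hx, hy]; abel
  | ι_mul x m hx =>
    simp only [differential] at hx ⊢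
    rw [mul_assoc, CliffordAlgebra.contractLeft_ι_mul, hx, CliffordAlgebra.contractLeft_ι_mul]
    simp only [map_mul, CliffordAlgebra.involute_ι, sub_mul, mul_add, smul_mul_assoc, neg_mul,
      mul_assoc]
    abel

theorem differential_involute (P : PureSullivanAlgebra.{u}) (a : P.Alg) :
    P.differential (CliffordAlgebra.involute a) =
      -CliffordAlgebra.involute (P.differential a) := by
  induction a using CliffordAlgebra.left_induction with
  | algebraMap r => simp [differential, CliffordAlgebra.contractLeft_algebraMap]
  | add x y hx hy => simp only [map_add, hx, hy, neg_add]
  | ι_mul x m hx =>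
    simp only [differential] at hx ⊢
    simp only [map_mul, CliffordAlgebra.involute_ι, neg_mul, map_neg,
      CliffordAlgebra.contractLeft_ι_mul, map_sub, map_smul, hx]
    simp

/-- The `ℚ`-subalgebra of cocycles `ker d`. -/
noncomputable def cocycles (P : PureSullivanAlgebra.{u}) : Subalgebra ℚ P.Alg where
  carrier := {a | P.differential a = 0}
  mul_mem' {a b} ha hb := by
    simp only [Set.mem_ofPred_eq] at ha hb ⊢
    rw [differential_mul, ha, hb, zero_mul, mul_zero, add_zero]
  add_mem' {a b} ha hb := by
    simp only [Set.mem_ofPred_eq] at ha hb ⊢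
    rw [map_add, ha, hb, add_zero]
  algebraMap_mem' r := by
    simp only [Set.mem_ofPred_eq]
    rw [IsScalarTower.algebraMap_apply ℚ P.EvenAlg P.Alg]
    exact P.differential_algebraMap _

/-- The coboundaries `im d`, an ideal of the algebra of cocycles. -/
noncomputable def coboundaries (P : PureSullivanAlgebra.{u}) : Ideal P.cocycles where
  carrier := {z | ∃ a : P.Alg, P.differential a = z}
  add_mem' := by
    rintro z w ⟨a, ha⟩ ⟨b, hb⟩
    exact ⟨a + b, by rw [map_add, ha, hb]; rfl⟩
  zero_mem' := ⟨0, map_zero _⟩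
  smul_mem' := by
    rintro c z ⟨a, ha⟩
    have hc : P.differential (c : P.Alg) = 0 := c.2
    refine ⟨CliffordAlgebra.involute (c : P.Alg) * a, ?_⟩
    rw [differential_mul, differential_involute, hc, map_zero, neg_zero, zero_mul, zero_add,
      CliffordAlgebra.involute_involute, ha]
    rfl

instance (P : PureSullivanAlgebra.{u}) : P.coboundaries.IsTwoSided where
  mul_mem_of_left := by
    rintro z c ⟨a, ha⟩
    have hc : P.differential (c : P.Alg) = 0 := c.2
    refine ⟨a * (c : P.Alg), ?_⟩
    rw [differential_mul, hc, mul_zero, add_zero, ha]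
    rfl

/-- The cohomology algebra `H(ΛV, d) = ker d / im d`. -/
abbrev Cohomology (P : PureSullivanAlgebra.{u}) : Type u := P.cocycles ⧸ P.coboundaries

/-- The homogeneous part `(ΛV)^m`, spanned by the monomials in the generators that have
total degree `m`. -/
noncomputable def degreePart (P : PureSullivanAlgebra.{u}) (m : ℕ) : Submodule ℚ P.Alg :=
  Submodule.span ℚ {a | ∃ (s : P.EvenGen →₀ ℕ) (l : List P.OddGen),
    Finsupp.weight P.evenDeg s + (l.map P.oddDeg).sum = m ∧
      a = algebraMap P.EvenAlg P.Alg (MvPolynomial.monomial s 1) * (l.map P.oddGen).prod}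

/-- `H^m(ΛV, d)`: the classes represented by cocycles of degree `m`. -/
noncomputable def cohomologyPart (P : PureSullivanAlgebra.{u}) (m : ℕ) :
    Submodule ℚ P.Cohomology :=
  ((P.degreePart m).comap P.cocycles.val.toLinearMap).map
    ((Submodule.mkQ P.coboundaries).restrictScalars ℚ)

/-- `H^{>0}(ΛV, d)`. -/
noncomputable def positiveCohomology (P : PureSullivanAlgebra.{u}) :
    Submodule ℚ P.Cohomology :=
  ⨆ m : ℕ, P.cohomologyPart (m + 1)

/-- The cup-length: the supremum in `ℕ ∪ {∞}` of the numbers `N` such that some product of `N`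
classes in `H^{>0}(ΛV, d)` is non-zero. -/
noncomputable def cupLength (P : PureSullivanAlgebra.{u}) : ℕ∞ :=
  sSup {m : ℕ∞ | ∃ (N : ℕ) (c : Fin N → P.Cohomology),
    m = N ∧ (∀ i, c i ∈ P.positiveCohomology) ∧ (List.ofFn c).prod ≠ 0}

/-- Ellipticity: both `V` and `H(ΛV, d)` are finite-dimensional over `ℚ`. -/
def IsElliptic (P : PureSullivanAlgebra.{u}) : Prop :=
  Finite P.EvenGen ∧ Finite P.OddGen ∧ FiniteDimensional ℚ P.Cohomology

end PureSullivanAlgebra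

/-- `∑_{l=1}^k x_r^{k-l} x_s^{l-1}` for an unordered pair `{r, s}`. -/
noncomputable def edgePolynomial {V : Type*} (k : ℕ) : Sym2 V → MvPolynomial V ℚ :=
  Sym2.lift ⟨fun r s => ∑ l ∈ Finset.Icc 1 k,
      (MvPolynomial.X r) ^ (k - l) * (MvPolynomial.X s) ^ (l - 1), by
    intro r s
    refine Finset.sum_nbij' (fun l => k + 1 - l) (fun l => k + 1 - l) ?_ ?_ ?_ ?_ ?_
    · intro l hl; simp only [Finset.mem_Icc] at hl ⊢; omega
    · intro l hl; simp only [Finset.mem_Icc] at hl ⊢; omega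
    · intro l hl; simp only [Finset.mem_Icc] at hl; omega
    · intro l hl; simp only [Finset.mem_Icc] at hl; omega
    · intro l hl
      simp only [Finset.mem_Icc] at hl
      rw [mul_comm, show k + 1 - l - 1 = k - l by omega, show k - (k + 1 - l) = l - 1 by omega]⟩

theorem edgePolynomial_homogeneous {V : Type*} (k : ℕ) (hk : 2 ≤ k) (e : Sym2 V) :
    (edgePolynomial k e).IsWeightedHomogeneous (fun _ : V => 2) (2 * k - 3 + 1) := by
  induction e using Sym2.ind with
  | _ r s =>
    simp only [edgePolynomial, Sym2.lift_mk]
    refine MvPolynomial.IsWeightedHomogeneous.sum _ _ _ fun l hl => ?_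
    simp only [Finset.mem_Icc] at hl
    have h := ((MvPolynomial.isWeightedHomogeneous_X ℚ (fun _ : V => 2) r).pow (k - l)).mul
      ((MvPolynomial.isWeightedHomogeneous_X ℚ (fun _ : V => 2) s).pow (l - 1))
    convert h using 1
    simp only [smul_eq_mul]
    omega

/-- The pure Sullivan algebra `(ΛV_{G,k}, d)` of a graph `G`: generators `x_v` of degree `2` for
the vertices, `y_e` of degree `2k - 3` for the edges, with `d x_v = 0` and
`d y_{rs} = ∑_{l=1}^k x_r^{k-l} x_s^{l-1}`. -/
noncomputable def graphAlgebra {V : Type*} (G : SimpleGraph V) (k : ℕ) (hk : 2 ≤ k) :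
    PureSullivanAlgebra where
  EvenGen := V
  OddGen := G.edgeSet
  evenDeg _ := 2
  oddDeg _ := 2 * k - 3
  evenDeg_pos _ := two_pos
  even_evenDeg _ := even_two
  odd_oddDeg _ := ⟨k - 2, by omega⟩
  dOdd e := edgePolynomial k (e : Sym2 V)
  dOdd_homogeneous e := edgePolynomial_homogeneous k hk (e : Sym2 V)

/-- `d'_{n,k} = ⌈(n(n-1)(2k-3) - n) / 2⌉`. -/
noncomputable def dPrime (n k : ℕ) : ℕ :=
  ⌈((n : ℚ) * (n - 1) * (2 * k - 3) - n) / 2⌉₊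

/-- For `k ≥ 2` the rounded number is never negative, so no truncation happens in `dPrime`. -/
theorem dPrime_eq_ceil (n k : ℕ) (hk : 2 ≤ k) :
    (dPrime n k : ℤ) = ⌈((n : ℚ) * (n - 1) * (2 * k - 3) - n) / 2⌉ := by
  have hk' : (2 : ℚ) ≤ k := by exact_mod_cast hk
  have h : (-1 : ℤ) < ⌈((n : ℚ) * (n - 1) * (2 * k - 3) - n) / 2⌉ := by
    rw [Int.lt_ceil]
    push_cast
    rcases n with _ | _ | n
    · norm_num
    · norm_num
    · have hn : (0 : ℚ) ≤ n := Nat.cast_nonneg n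
      push_cast
      nlinarith [mul_nonneg (mul_nonneg (by linarith : (0 : ℚ) ≤ n + 2)
        (by linarith : (0 : ℚ) ≤ n + 1)) (by linarith : (0 : ℚ) ≤ (k : ℚ) - 2),
        mul_nonneg hn hn]
  rw [dPrime, ← Int.ceil_toNat, Int.toNat_of_nonneg (by omega)]

/-- The pure Sullivan algebra `(ΛW_{G,k}, d)` of a graph `G` on `n` vertices: `(ΛV_{G,k}, d)`
with additional generators `z_v` of degree `4 (d'_{n,k} + n) + 3` for the vertices, where
`d z_v = x_v ^ (2 (d'_{n,k} + n + 1))`. -/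
noncomputable def extendedGraphAlgebra {V : Type*} [Fintype V] (G : SimpleGraph V) (k : ℕ)
    (hk : 2 ≤ k) : PureSullivanAlgebra where
  EvenGen := V
  OddGen := G.edgeSet ⊕ V
  evenDeg _ := 2
  oddDeg := Sum.elim (fun _ => 2 * k - 3)
    (fun _ => 4 * (dPrime (Fintype.card V) k + Fintype.card V) + 3)
  evenDeg_pos _ := two_pos
  even_evenDeg _ := even_two
  odd_oddDeg := by
    rintro (e | v)
    · exact ⟨k - 2, by simp only [Sum.elim_inl]; omega⟩
    · exact ⟨2 * (dPrime (Fintype.card V) k + Fintype.card V) + 1,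
        by simp only [Sum.elim_inr]; omega⟩
  dOdd := Sum.elim (fun e => edgePolynomial k (e : Sym2 V))
    (fun v => MvPolynomial.X v ^ (2 * (dPrime (Fintype.card V) k + Fintype.card V + 1)))
  dOdd_homogeneous := by
    rintro (e | v)
    · exact edgePolynomial_homogeneous k hk (e : Sym2 V)
    · have h := (MvPolynomial.isWeightedHomogeneous_X ℚ (fun _ : V => 2) v).pow
        (2 * (dPrime (Fintype.card V) k + Fintype.card V + 1))
      simp only [Sum.elim_inr]
      convert h using 1
      simp only [smul_eq_mul]
      omega

/-!
Write `A = ℚ[x_v]`, and let `I` be the ideal generated by the polynomials `d y_e`. The proof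
compares both statements with the condition that every `x_v` is nilpotent modulo `I`.

If `x_v` is not nilpotent modulo `I`, then the cohomology of `ΛV` is infinite-dimensional, as the
projection `ΛV → A / I` kills coboundaries and the powers of `x_v` are linearly independent in the
graded algebra `A / I`. Also, the class of `x_v ^ (d' + n + 1)` in `H(ΛW)` is non-zero, because
the differentials of the `z_u` have polynomial degree `2 (d' + n + 1)` and cannot contribute to
it; so the cup-length of `ΛW` exceeds `d' + n`.

If all `x_v` are nilpotent modulo `I`, both finiteness statements follow from one vanishing
result, `exists_contractLeft_eq_of_mem_weightFiltration`. Give each `x_v` the weight `2` and each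
odd generator `j` some weight `w j`, and let `x_v ^ N = d m_v` with odd elements `m_v` of weight
at least `2 N - 1`, for all `v`. If `c` is a cocycle of weight more than `∑ w - n`, the product of
`c` with all the `m_v` has weight more than `∑ w + 2 n (N - 1)`, so each of its monomials is
divisible by some `x_v ^ N`. The factors `m_v` can then be removed one by one: since `d (m_v b) =
x_v ^ N b - m_v d b` and `x_v ^ N` is regular on the complex modulo the powers of the other
variables, `b` is a coboundary modulo those other powers whenever `m_v b` is one modulo all of
them. In the end, `c` is a coboundary.

When the weights are the degrees, this says that cocycles of degree above the formal dimension are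
coboundaries, and so the cohomology is finite-dimensional. For `ΛW`, give the `y_e` their degree
`2 k - 3` and the `z_v` the weight `1`. The result asks for no relation between the weights and
the differential beyond the elements `m_v`, which exist already in `ΛV`. Elements of positive
degree have weight at least one, so a product of more than `|E| (2 k - 3)` positive classes
vanishes in `H(ΛW)`, and `|E| (2 k - 3) ≤ d' + n`.
-/

/-- The underlying algebra of the Koszul complex of a family of elements of `R[σ]` indexed by `ι`:
the exterior algebra of a free `R[σ]`-module. -/
abbrev KoszulAlgebra (R σ ι : Type*) [CommRing R] : Type _ :=
  ExteriorAlgebra (MvPolynomial σ R) (ι →₀ MvPolynomial σ R)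

/-! ### The weight filtration on exterior algebras over polynomial rings -/

open MvPolynomial in
/-- The `p`-th step of the weight filtration on the exterior algebra of the free module `R[σ]^ι`:
the `R[σ]`-span of the products `x ^ s * y_{j₁} ⋯ y_{jᵣ}` of weight at least `p`, where each
variable has weight `2` and the basis vector `y_j` has weight `w j`. As all weights are
nonnegative, this is an `R[σ]`-submodule. -/
noncomputable def weightFiltration (R σ : Type*) {ι : Type*} [CommRing R] (w : ι → ℕ) (p : ℕ) :
    Submodule (MvPolynomial σ R) (KoszulAlgebra R σ ι) :=
  Submodule.span _ {a | ∃ (s : σ →₀ ℕ) (l : List ι), p ≤ 2 * s.degree + (l.map w).sum ∧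
    a = algebraMap _ _ (monomial s (1 : R)) *
      (l.map fun j => ExteriorAlgebra.ι (MvPolynomial σ R) (Finsupp.single j 1)).prod}

namespace weightFiltration

open MvPolynomial

variable {R σ ι : Type*} [CommRing R] {w : ι → ℕ} {p q : ℕ}

theorem antitone (h : p ≤ q) : weightFiltration R σ w q ≤ weightFiltration R σ w p := by
  refine Submodule.span_mono ?_
  rintro a ⟨s, l, hl, rfl⟩
  exact ⟨s, l, h.trans hl, rfl⟩

theorem mul_mem {a b : KoszulAlgebra R σ ι}
    (ha : a ∈ weightFiltration R σ w p) (hb : b ∈ weightFiltration R σ w q) :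
    a * b ∈ weightFiltration R σ w (p + q) := by
  have h := Submodule.mul_mem_mul ha hb
  rw [weightFiltration, weightFiltration, Submodule.span_mul_span] at h
  refine Submodule.span_mono ?_ h
  rintro _ ⟨_, ⟨s, l, hl, rfl⟩, _, ⟨t, m, hm, rfl⟩, rfl⟩
  refine ⟨s + t, l ++ m, ?_, ?_⟩
  · rw [map_add, List.map_append, List.sum_append]
    omega
  · dsimp only
    rw [List.map_append, List.prod_append,
      show monomial (s + t) (1 : R) = monomial s 1 * monomial t 1 by
      rw [monomial_mul, one_mul], map_mul (algebraMap _ _), mul_assoc, mul_assoc]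
    congr 1
    rw [← mul_assoc, ← Algebra.commutes, mul_assoc]

theorem ι_single_mem (j : ι) :
    ExteriorAlgebra.ι _ (Finsupp.single j 1) ∈ weightFiltration R σ w (w j) :=
  Submodule.subset_span ⟨0, [j], by simp, by simp⟩

theorem monomial_mem (s : σ →₀ ℕ) (r : R) :
    algebraMap _ _ (monomial s r) ∈ weightFiltration R σ w (2 * s.degree) := by
  have h : algebraMap _ _ (monomial s (1 : R)) ∈ weightFiltration R σ w (2 * s.degree) :=
    Submodule.subset_span ⟨s, [], by simp, by simp⟩
  rw [show monomial s r = C r * monomial s 1 by simp [C_mul_monomial], map_mul,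
    ← Algebra.smul_def]
  exact Submodule.smul_mem _ _ h

theorem algebraMap_mem (f : MvPolynomial σ R) : algebraMap _ _ f ∈ weightFiltration R σ w 0 := by
  rw [Algebra.algebraMap_eq_smul_one]
  exact Submodule.smul_mem _ _ (Submodule.subset_span ⟨0, [], by simp, by simp⟩)

theorem algebraMap_mem_of_isHomogeneous {f : MvPolynomial σ R} {m : ℕ} (hf : f.IsHomogeneous m) :
    algebraMap _ _ f ∈ weightFiltration R σ w (2 * m) := by
  rw [f.as_sum, map_sum]
  refine Submodule.sum_mem _ fun s hs => ?_
  have h := hf (mem_support_iff.1 hs)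
  rw [show (1 : σ → ℕ) = fun _ => 1 from rfl, ← Finsupp.degree_eq_weight_one] at h
  have := monomial_mem (w := w) s (coeff s f)
  rwa [h] at this

/-- A product of exterior generators with a repeated factor vanishes. -/
theorem prod_map_ι_eq_zero {l : List ι} (hl : ¬ l.Nodup) :
    (l.map fun j =>
      ExteriorAlgebra.ι (MvPolynomial σ R) (Finsupp.single j (1 : MvPolynomial σ R))).prod = 0 := by
  rw [List.nodup_iff_injective_get] at hl
  simp only [Function.Injective, not_forall] at hl
  obtain ⟨i, j, hij, hne⟩ := hl
  have h := (ExteriorAlgebra.ιMulti (MvPolynomial σ R) l.length).map_eq_zero_of_eq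
    (fun i => Finsupp.single (l.get i) (1 : MvPolynomial σ R)) (by rw [hij]) hne
  rw [ExteriorAlgebra.ιMulti_apply] at h
  rw [← h]
  congr 1
  conv_lhs => rw [← List.ofFn_get l, List.map_ofFn]
  rfl

end weightFiltration

/-! ### Cocycles of large weight are coboundaries -/

/-- The monomial ideal generated by the `N`-th powers of the variables in `S`. -/
noncomputable def powIdeal {σ : Type*} (R : Type*) [CommRing R] (N : ℕ) (S : Set σ) :
    Ideal (MvPolynomial σ R) :=
  Ideal.span ((fun v => MvPolynomial.X v ^ N) '' S)

namespace powIdeal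

open MvPolynomial

variable {R σ : Type*} [CommRing R] {N : ℕ} {S : Set σ}

theorem X_pow_mem {v : σ} (hv : v ∈ S) : X v ^ N ∈ powIdeal R N S :=
  Ideal.subset_span ⟨v, hv, rfl⟩

theorem mem_iff {f : MvPolynomial σ R} :
    f ∈ powIdeal R N S ↔ ∀ s ∈ f.support, ∃ v ∈ S, N ≤ s v := by
  have h : ((fun v => X v ^ N) '' S : Set (MvPolynomial σ R)) =
      (fun s => monomial s (1 : R)) '' ((fun v => Finsupp.single v N) '' S) := by
    rw [Set.image_image]
    simp only [X_pow_eq_monomial]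
  rw [powIdeal, h, mem_ideal_span_monomial_image]
  simp only [Set.exists_mem_image, Finsupp.single_le_iff]

theorem mem_of_X_pow_mul_mem {v : σ} (hv : v ∉ S) {f : MvPolynomial σ R}
    (h : X v ^ N * f ∈ powIdeal R N S) : f ∈ powIdeal R N S := by
  rw [mem_iff] at h ⊢
  intro s hs
  obtain ⟨t, ht, hN⟩ := h (Finsupp.single v N + s) (by
    rw [X_pow_eq_monomial, mem_support_iff, coeff_monomial_mul, one_mul]
    exact mem_support_iff.1 hs)
  refine ⟨t, ht, ?_⟩
  rwa [Finsupp.add_apply, Finsupp.single_eq_of_ne (by rintro rfl; exact hv ht), zero_add] at hN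

end powIdeal

/-- Membership in `I • M` for a free module `M` is tested on coordinates. -/
theorem Module.Basis.mem_ideal_smul_top_iff {A M β : Type*} [CommRing A] [AddCommGroup M]
    [Module A M] (b : Module.Basis β A M) (I : Ideal A) (x : M) :
    x ∈ I • (⊤ : Submodule A M) ↔ ∀ i, b.repr x i ∈ I := by
  constructor
  · intro hx i
    induction hx using Submodule.smul_induction_on' with
    | smul r hr n _ =>
      rw [map_smul, Finsupp.smul_apply, smul_eq_mul]
      exact I.mul_mem_right _ hr
    | add x _ y _ hx hy =>
      rw [map_add, Finsupp.add_apply]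
      exact I.add_mem hx hy
  · intro h
    rw [← b.linearCombination_repr x, Finsupp.linearCombination_apply]
    exact Submodule.sum_mem _ fun i _ => Submodule.smul_mem_smul (h i) trivial

section Vanishing

open MvPolynomial CliffordAlgebra

variable {R σ ι : Type*} [CommRing R] {N : ℕ}

/-- `x_v ^ N` is regular modulo the `N`-th powers of the other variables. -/
theorem mem_powIdeal_smul_top_of_X_pow_smul_mem {S : Set σ} {v : σ} (hv : v ∉ S)
    {a : KoszulAlgebra R σ ι}
    (h : (X v ^ N : MvPolynomial σ R) • a ∈
      powIdeal R N S • (⊤ : Submodule (MvPolynomial σ R) (KoszulAlgebra R σ ι))) :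
    a ∈ powIdeal R N S • (⊤ : Submodule (MvPolynomial σ R) (KoszulAlgebra R σ ι)) := by
  classical
  let : LinearOrder ι := linearOrderOfSTO WellOrderingRel
  let b := (Finsupp.basisSingleOne (R := MvPolynomial σ R) (ι := ι)).ExteriorAlgebra
  rw [b.mem_ideal_smul_top_iff] at h ⊢
  intro i
  refine powIdeal.mem_of_X_pow_mul_mem hv ?_
  have := h i
  rwa [map_smul, Finsupp.smul_apply, smul_eq_mul] at this

/-- In large weight, every monomial is divisible by the `N`-th power of some variable. -/
theorem weightFiltration_le_powIdeal_smul_top [Fintype σ] [Fintype ι]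
    (w : ι → ℕ) {p : ℕ}
    (hp : ∑ j, w j + 2 * (Fintype.card σ * (N - 1)) < p) :
    weightFiltration R σ w p ≤ powIdeal R N (Set.univ : Set σ) •
      (⊤ : Submodule (MvPolynomial σ R) (KoszulAlgebra R σ ι)) := by
  classical
  refine Submodule.span_le.2 ?_
  rintro a ⟨s, l, hl, rfl⟩
  by_cases hnd : l.Nodup
  · have hw : (l.map w).sum ≤ ∑ j, w j := by
      rw [← List.sum_toFinset _ hnd]
      exact Finset.sum_le_sum_of_subset (Finset.subset_univ _)
    obtain ⟨v, hv⟩ : ∃ v, N ≤ s v := by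
      by_contra! hlt
      have h := Finset.sum_le_card_nsmul Finset.univ s (N - 1) fun v _ =>
        Nat.le_sub_one_of_lt (hlt v)
      rw [← Finsupp.degree_eq_sum, Finset.card_univ, smul_eq_mul] at h
      omega
    rw [SetLike.mem_coe, ← Algebra.smul_def]
    refine Submodule.smul_mem_smul ?_ trivial
    rw [powIdeal.mem_iff]
    intro t ht
    rw [Finset.mem_singleton.1 (support_monomial_subset ht)]
    exact ⟨v, trivial, hv⟩
  · rw [weightFiltration.prod_map_ι_eq_zero hnd, mul_zero]
    exact zero_mem _

theorem Submodule.mul_left_mem_smul_top {A B : Type*} [CommRing A] [Ring B] [Algebra A B]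
    {I : Ideal A} (a : B) {b : B} (hb : b ∈ I • (⊤ : Submodule A B)) :
    a * b ∈ I • (⊤ : Submodule A B) := by
  induction hb using Submodule.smul_induction_on' with
  | smul r hr n _ =>
    rw [mul_smul_comm]
    exact Submodule.smul_mem_smul hr trivial
  | add x _ y _ hx hy =>
    rw [mul_add]
    exact add_mem hx hy

theorem LinearMap.map_mem_smul_top {A B : Type*} [CommRing A] [AddCommGroup B] [Module A B]
    {I : Ideal A} (f : B →ₗ[A] B) {b : B} (hb : b ∈ I • (⊤ : Submodule A B)) :
    f b ∈ I • (⊤ : Submodule A B) := by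
  have h := Submodule.mem_map_of_mem (f := f) hb
  rw [Submodule.map_smul''] at h
  exact Submodule.smul_mono le_rfl le_top h

variable (f : Module.Dual (MvPolynomial σ R) (ι →₀ MvPolynomial σ R))
  (m : σ → ι →₀ MvPolynomial σ R)

/-- Multiplying a cocycle by odd elements `m v` with `d (m v) = x_v ^ N`, `v ∈ l`, gives a cocycle
modulo the `x_v ^ N`, `v ∈ l`. -/
theorem contractLeft_prod_mul_mem (hm : ∀ v, f (m v) = X v ^ N)
    {c : KoszulAlgebra R σ ι}
    (hc : contractLeft f c = 0) (l : List σ) :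
    contractLeft f ((l.map fun v => ExteriorAlgebra.ι _ (m v)).prod * c) ∈
      powIdeal R N {v | v ∈ l} • (⊤ : Submodule (MvPolynomial σ R) (KoszulAlgebra R σ ι)) := by
  induction l with
  | nil => simp [hc]
  | cons v l ih =>
    have hle : powIdeal R N {v | v ∈ l} ≤ powIdeal R N {w | w ∈ v :: l} :=
      Ideal.span_mono (Set.image_mono fun w hw => List.mem_cons_of_mem _ hw)
    rw [List.map_cons, List.prod_cons, mul_assoc, contractLeft_ι_mul, hm]
    refine sub_mem (Submodule.smul_mem_smul (powIdeal.X_pow_mem (by simp)) trivial) ?_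
    exact Submodule.smul_mono hle le_rfl (Submodule.mul_left_mem_smul_top _ ih)

/-- If the product of a cocycle `c` with the `m v`, `v ∈ l`, is a coboundary modulo the `x_v ^ N`,
`v ∈ l`, then `c` is a coboundary: the factors are removed one at a time, as `x_v ^ N` is regular
modulo the other powers. -/
theorem mem_range_of_prod_mul_mem (hm : ∀ v, f (m v) = X v ^ N)
    {c : KoszulAlgebra R σ ι}
    (hc : contractLeft f c = 0) (l : List σ) (hl : l.Nodup)
    (h : (l.map fun v => ExteriorAlgebra.ι _ (m v)).prod * c ∈
      LinearMap.range (contractLeft f) ⊔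
        powIdeal R N {v | v ∈ l} • (⊤ : Submodule (MvPolynomial σ R) (KoszulAlgebra R σ ι))) :
    c ∈ LinearMap.range (contractLeft f) := by
  induction l with
  | nil => simpa [powIdeal] using h
  | cons v l ih =>
    rw [List.nodup_cons] at hl
    refine ih hl.2 ?_
    set b := (l.map fun v => ExteriorAlgebra.ι _ (m v)).prod * c with hb
    have hspan : powIdeal R N {w | w ∈ v :: l} =
        Ideal.span {X v ^ N} ⊔ powIdeal R N {w | w ∈ l} := by
      rw [powIdeal, powIdeal, ← Ideal.span_union, show {w | w ∈ v :: l} = {v} ∪ {w | w ∈ l} by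
        ext; simp, Set.image_union, Set.image_singleton]
    rw [List.map_cons, List.prod_cons, mul_assoc, ← hb, hspan, Submodule.sup_smul] at h
    obtain ⟨_, ⟨e, rfl⟩, y, hy, hey⟩ := Submodule.mem_sup.1 h
    obtain ⟨g', hg', z, hz, rfl⟩ := Submodule.mem_sup.1 hy
    rw [Submodule.ideal_span_singleton_smul] at hg'
    obtain ⟨g, -, rfl⟩ := Submodule.mem_smul_pointwise_iff_exists _ _ _ |>.1 hg'
    have hd := congrArg (contractLeft f) hey
    rw [map_add, map_add, contractLeft_contractLeft, zero_add, map_smul, contractLeft_ι_mul,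
      hm] at hd
    have hreg : (X v ^ N : MvPolynomial σ R) • (b - contractLeft f g) ∈
        powIdeal R N {w | w ∈ l} • (⊤ : Submodule (MvPolynomial σ R) (KoszulAlgebra R σ ι)) := by
      have : (X v ^ N : MvPolynomial σ R) • (b - contractLeft f g) =
          contractLeft f z + ExteriorAlgebra.ι _ (m v) * contractLeft f b := by
        rw [smul_sub, sub_eq_iff_eq_add, add_right_comm, add_comm (contractLeft f z), hd,
          sub_add_cancel]
      rw [this]
      exact add_mem (LinearMap.map_mem_smul_top _ hz)
        (Submodule.mul_left_mem_smul_top _ (contractLeft_prod_mul_mem f m hm hc l))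
    have := mem_powIdeal_smul_top_of_X_pow_smul_mem (by simpa using hl.1) hreg
    rw [← add_sub_cancel (contractLeft f g) b]
    exact add_mem (Submodule.mem_sup_left ⟨g, rfl⟩) (Submodule.mem_sup_right this)

/-- If `x_v ^ N` is the differential of an odd element of weight at least `2 N - 1` for every `v`,
then cocycles of weight greater than `∑ w - |σ|` are coboundaries. -/
theorem exists_contractLeft_eq_of_mem_weightFiltration [Fintype σ] [Fintype ι]
    (w : ι → ℕ) (hN : 1 ≤ N) (hm : ∀ v, f (m v) = X v ^ N)
    (hmw : ∀ v, ExteriorAlgebra.ι _ (m v) ∈ weightFiltration R σ w (2 * N - 1)) {p : ℕ}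
    (hp : ∑ j, w j < p + Fintype.card σ)
    {c : KoszulAlgebra R σ ι}
    (hc : contractLeft f c = 0) (hcw : c ∈ weightFiltration R σ w p) :
    ∃ a, contractLeft f a = c := by
  have hprod (l : List σ) : (l.map fun v => ExteriorAlgebra.ι _ (m v)).prod * c ∈
      weightFiltration R σ w (l.length * (2 * N - 1) + p) := by
    induction l with
    | nil => simpa using hcw
    | cons v l ih =>
      rw [List.map_cons, List.prod_cons, mul_assoc, List.length_cons]
      rw [show (l.length + 1) * (2 * N - 1) + p = 2 * N - 1 + (l.length * (2 * N - 1) + p) by ring]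
      exact weightFiltration.mul_mem (hmw v) ih
  refine mem_range_of_prod_mul_mem f m hm hc Finset.univ.toList (Finset.nodup_toList _)
    (Submodule.mem_sup_right ?_)
  have huniv : {v : σ | v ∈ Finset.univ.toList} = Set.univ := by ext; simp
  rw [huniv]
  refine weightFiltration_le_powIdeal_smul_top w ?_ (hprod _)
  obtain ⟨N, rfl⟩ := Nat.exists_eq_add_of_le' hN
  rw [Finset.length_toList, Finset.card_univ, show 2 * (N + 1) - 1 = 2 * N + 1 by omega,
    Nat.add_sub_cancel]
  nlinarith

end Vanishing

/-! ### Homogeneous combinations of homogeneous polynomials -/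

section Homogeneous

open MvPolynomial

variable {R σ ι : Type*} [CommRing R]

attribute [local instance] MvPolynomial.gradedAlgebra in
theorem MvPolynomial.homogeneousComponent_mul_of_isHomogeneous {g f : MvPolynomial σ R} {a : ℕ}
    (hf : f.IsHomogeneous a) (n : ℕ) :
    homogeneousComponent n (g * f) = if a ≤ n then homogeneousComponent (n - a) g * f else 0 := by
  have h := DirectSum.coe_decompose_mul_of_right_mem (𝒜 := homogeneousSubmodule σ R) (a := g) n
    ((mem_homogeneousSubmodule _ _).2 hf)
  have hc (n : ℕ) (g : MvPolynomial σ R) :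
      (DirectSum.decompose (homogeneousSubmodule σ R) g n : MvPolynomial σ R) =
        homogeneousComponent n g := decomposition.decompose'_apply g n
  rwa [hc, hc] at h

/-- A combination of homogeneous polynomials `f j` of degree `a j` can be cut down to any degree `n`
by replacing each coefficient by its component of degree `n - a j`. -/
theorem MvPolynomial.exists_homogeneousComponent_eq_linearCombination
    {f : ι → MvPolynomial σ R} {a : ι → ℕ}
    (hf : ∀ j, (f j).IsHomogeneous (a j)) (n : ℕ) (g : ι →₀ MvPolynomial σ R) :
    ∃ g' : ι →₀ MvPolynomial σ R, (∀ j, (g' j).IsHomogeneous (n - a j)) ∧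
      (∀ j, n < a j → g' j = 0) ∧
      homogeneousComponent n (Finsupp.linearCombination (MvPolynomial σ R) f g) =
        Finsupp.linearCombination (MvPolynomial σ R) f g' := by
  classical
  induction g using Finsupp.induction_linear with
  | zero => exact ⟨0, fun j => isHomogeneous_zero _ _ _, fun _ _ => rfl, by simp⟩
  | add g₁ g₂ h₁ h₂ =>
    obtain ⟨g₁', h₁, h₁', e₁⟩ := h₁
    obtain ⟨g₂', h₂, h₂', e₂⟩ := h₂
    exact ⟨g₁' + g₂', fun j => (h₁ j).add (h₂ j),
      fun j hj => by rw [Finsupp.add_apply, h₁' j hj, h₂' j hj, add_zero],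
      by rw [map_add, map_add, map_add, e₁, e₂]⟩
  | single i p =>
    rw [Finsupp.linearCombination_single, smul_eq_mul,
      homogeneousComponent_mul_of_isHomogeneous (hf i)]
    split_ifs with hi
    · refine ⟨Finsupp.single i (homogeneousComponent (n - a i) p), fun j => ?_, fun j hj => ?_, ?_⟩
      · rw [Finsupp.single_apply]
        split_ifs with hij
        · subst hij
          exact homogeneousComponent_isHomogeneous _ _
        · exact isHomogeneous_zero _ _ _
      · rw [Finsupp.single_eq_of_ne (by rintro rfl; omega)]
      · rw [Finsupp.linearCombination_single, smul_eq_mul]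
    · exact ⟨0, fun j => isHomogeneous_zero _ _ _, fun _ _ => rfl, by simp⟩

theorem weightFiltration.ι_mapDomain_mem (w : ι → ℕ) {κ : Type*} (φ : κ → ι)
    (g : κ →₀ MvPolynomial σ R) {p : ℕ}
    (h : ∀ j ∈ g.support, ∃ b, (g j).IsHomogeneous b ∧ p ≤ 2 * b + w (φ j)) :
    ExteriorAlgebra.ι _ (g.mapDomain φ) ∈ weightFiltration R σ w p := by
  rw [Finsupp.mapDomain, Finsupp.sum, map_sum]
  refine Submodule.sum_mem _ fun j hj => ?_
  obtain ⟨b, hb, hp⟩ := h j hj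
  rw [← mul_one (g j), ← smul_eq_mul, ← Finsupp.smul_single, map_smul, Algebra.smul_def]
  exact antitone hp (mul_mem (algebraMap_mem_of_isHomogeneous hb) (ι_single_mem _))

end Homogeneous

/-! ### Pure Sullivan algebras with even generators of degree two -/

namespace PureSullivanAlgebra

open MvPolynomial CliffordAlgebra

universe u

variable (P : PureSullivanAlgebra.{u})

/-- The ideal of `ΛV^even` generated by the differentials of the odd generators. -/
noncomputable def boundaryIdeal : Ideal P.EvenAlg :=
  Ideal.span (Set.range P.dOdd)

variable {P}

theorem mem_boundaryIdeal_iff {q : P.EvenAlg} : q ∈ P.boundaryIdeal ↔ ∃ g, P.dForm g = q := by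
  rw [boundaryIdeal, Ideal.span, ← Finsupp.range_linearCombination]
  rfl

/-- A coboundary that lies in `ΛV^even` lies in the ideal of the differentials of the odd
generators, because the projection onto `ΛV^even` maps every coboundary there. -/
theorem mem_boundaryIdeal_of_differential_eq {q : P.EvenAlg} {a : P.Alg}
    (h : P.differential a = algebraMap _ _ q) : q ∈ P.boundaryIdeal := by
  have key (a : P.Alg) : ExteriorAlgebra.algebraMapInv (P.differential a) ∈ P.boundaryIdeal := by
    unfold differential
    induction a using CliffordAlgebra.left_induction with
    | algebraMap r => simp [contractLeft_algebraMap]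
    | add x y hx hy =>
      rw [map_add, map_add]
      exact add_mem hx hy
    | ι_mul x m hx =>
      have h0 : ExteriorAlgebra.algebraMapInv (CliffordAlgebra.ι _ m : P.Alg) = 0 :=
        (ExteriorAlgebra.lift_ι_apply _ _ _ _).trans rfl
      rw [contractLeft_ι_mul, map_sub, map_mul, h0, zero_mul, sub_zero, map_smul, smul_eq_mul]
      exact Ideal.mul_mem_right _ _ (mem_boundaryIdeal_iff.2 ⟨m, rfl⟩)
  have := key a
  rwa [h, ExteriorAlgebra.algebraMap_leftInverse] at this

theorem isHomogeneous_dOdd (h2 : ∀ i, P.evenDeg i = 2) {a : P.OddGen → ℕ}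
    (ha : ∀ j, P.oddDeg j + 1 = 2 * a j) (j : P.OddGen) : (P.dOdd j).IsHomogeneous (a j) := by
  intro s hs
  have h := P.dOdd_homogeneous j hs
  rw [show P.evenDeg = fun _ => 2 from funext h2, ha] at h
  rw [Finsupp.weight_apply, Finsupp.sum] at h ⊢
  simp only [smul_eq_mul, Pi.one_apply, mul_one] at h ⊢
  rw [← Finset.sum_mul] at h
  omega

theorem homogeneousComponent_mem_boundaryIdeal (h2 : ∀ i, P.evenDeg i = 2) {p : P.EvenAlg}
    (hp : p ∈ P.boundaryIdeal) (n : ℕ) : homogeneousComponent n p ∈ P.boundaryIdeal := by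
  have ha (j) : P.oddDeg j + 1 = 2 * ((P.oddDeg j + 1) / 2) := by
    obtain ⟨b, hb⟩ := P.odd_oddDeg j
    omega
  obtain ⟨g, rfl⟩ := mem_boundaryIdeal_iff.1 hp
  obtain ⟨g', -, -, h⟩ :=
    exists_homogeneousComponent_eq_linearCombination (isHomogeneous_dOdd h2 ha) n g
  rw [dForm, h]
  exact mem_boundaryIdeal_iff.2 ⟨g', rfl⟩

theorem mk_eq_zero_iff {z : P.cocycles} :
    Ideal.Quotient.mk P.coboundaries z = 0 ↔ ∃ a, P.differential a = z := by
  rw [Ideal.Quotient.eq_zero_iff_mem]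
  rfl

/-- If all even generators have degree two and the cohomology is finite-dimensional, then every
even generator is nilpotent modulo the differentials: its powers are linearly dependent in
cohomology, and the relations are homogeneous. -/
theorem exists_X_pow_mem_boundaryIdeal (h2 : ∀ i, P.evenDeg i = 2)
    [Module.Finite ℚ P.Cohomology] (v : P.EvenGen) : ∃ N, X v ^ N ∈ P.boundaryIdeal := by
  by_contra! hv
  let x : P.cocycles := ⟨P.evenGen v, P.differential_evenGen v⟩
  let θ : Polynomial ℚ →ₗ[ℚ] P.Cohomology :=
    ((Submodule.mkQ P.coboundaries).restrictScalars ℚ) ∘ₗ (Polynomial.aeval x).toLinearMap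
  have hθ : Function.Injective θ := by
    rw [← LinearMap.ker_eq_bot, LinearMap.ker_eq_bot']
    intro p hp
    obtain ⟨a, ha⟩ := mk_eq_zero_iff.1 hp
    have hx : ((Polynomial.aeval x p : P.cocycles) : P.Alg) =
        algebraMap P.EvenAlg P.Alg (Polynomial.aeval (X v : P.EvenAlg) p) := by
      rw [← Polynomial.aeval_algebraMap_apply]
      exact (Polynomial.aeval_algHom_apply P.cocycles.val x p).symm
    have hI := mem_boundaryIdeal_of_differential_eq (ha.trans hx)
    ext m
    by_contra hm
    refine hv m ?_
    have h := homogeneousComponent_mem_boundaryIdeal h2 hI m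
    have hcomp : homogeneousComponent m (Polynomial.aeval (X v : P.EvenAlg) p) =
        C (p.coeff m) * X v ^ m := by
      rw [Polynomial.aeval_eq_sum_range, map_sum]
      have hterm (i : ℕ) : homogeneousComponent m (p.coeff i • (X v : P.EvenAlg) ^ i) =
          if m = i then C (p.coeff m) * X v ^ m else 0 := by
        rw [homogeneousComponent_of_mem (n := i) (by
          rw [smul_eq_C_mul]
          exact (isHomogeneous_X_pow v i).C_mul _)]
        split_ifs with him
        · rw [him, smul_eq_C_mul]
        · rfl
      simp only [hterm, Finset.sum_ite_eq, Finset.mem_range]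
      split_ifs with hlt
      · rfl
      · rw [Polynomial.coeff_eq_zero_of_natDegree_lt (by omega), C_0, zero_mul]
    rw [hcomp] at h
    have h' := P.boundaryIdeal.mul_mem_left (C (p.coeff m)⁻¹) h
    rwa [← mul_assoc, ← C_mul, inv_mul_cancel₀ (by simpa using hm), C_1, one_mul] at h'
  exact Polynomial.not_finite (Module.Finite.of_injective θ hθ)

/-- A power of an even generator in the ideal of differentials bounds an odd element that is linear
in the odd generators and has coefficients of the expected degrees. -/
theorem exists_dForm_eq_X_pow (h2 : ∀ i, P.evenDeg i = 2) {a : P.OddGen → ℕ}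
    (ha : ∀ j, P.oddDeg j + 1 = 2 * a j) {v : P.EvenGen} {N : ℕ}
    (h : X v ^ N ∈ P.boundaryIdeal) : ∃ g : P.OddGen →₀ P.EvenAlg, P.dForm g = X v ^ N ∧
      ∀ j ∈ g.support, ∃ b, (g j).IsHomogeneous b ∧ 2 * N - 1 ≤ 2 * b + P.oddDeg j := by
  obtain ⟨g, hg⟩ := mem_boundaryIdeal_iff.1 h
  obtain ⟨g', h1, h2, h3⟩ :=
    exists_homogeneousComponent_eq_linearCombination (isHomogeneous_dOdd h2 ha) N g
  refine ⟨g', ?_, fun j hj => ⟨N - a j, h1 j, ?_⟩⟩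
  · rw [dForm, ← h3, ← dForm, hg]
    exact homogeneousComponent_eq_self (isHomogeneous_X_pow v N)
  · have hle : a j ≤ N := not_lt.1 fun hlt => Finsupp.mem_support_iff.1 hj (h2 j hlt)
    have := ha j
    omega

theorem exists_forall_X_pow_mem_boundaryIdeal [Finite P.EvenGen]
    (h : ∀ v, ∃ N, X v ^ N ∈ P.boundaryIdeal) :
    ∃ N, 1 ≤ N ∧ ∀ v, X v ^ N ∈ P.boundaryIdeal := by
  have := Fintype.ofFinite P.EvenGen
  choose N hN using h
  refine ⟨∑ v, N v + 1, by omega, fun v => ?_⟩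
  exact P.boundaryIdeal.pow_mem_of_pow_mem (hN v)
    ((Finset.single_le_sum (fun _ _ => Nat.zero_le _) (Finset.mem_univ v)).trans (Nat.le_succ _))

/-- The weight filtration for which the weight of a generator is its degree. -/
noncomputable abbrev degreeFiltration (P : PureSullivanAlgebra.{u}) (p : ℕ) :
    Submodule P.EvenAlg P.Alg :=
  weightFiltration ℚ P.EvenGen P.oddDeg p

/-- The bound `∑ |y| - ∑ (|x| - 1)` for the formal dimension: above it, cocycles are
coboundaries if all even generators are nilpotent modulo the differentials. -/
theorem exists_differential_eq_of_mem_degreeFiltration [Fintype P.EvenGen] [Fintype P.OddGen]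
    (h2 : ∀ i, P.evenDeg i = 2) (hnil : ∀ v, ∃ N, X v ^ N ∈ P.boundaryIdeal) {p : ℕ}
    (hp : ∑ j, P.oddDeg j < p + Fintype.card P.EvenGen) {c : P.Alg}
    (hc : P.differential c = 0) (hcp : c ∈ P.degreeFiltration p) :
    ∃ a, P.differential a = c := by
  have ha (j) : P.oddDeg j + 1 = 2 * ((P.oddDeg j + 1) / 2) := by
    obtain ⟨b, hb⟩ := P.odd_oddDeg j
    omega
  obtain ⟨N, hN1, hN⟩ := exists_forall_X_pow_mem_boundaryIdeal hnil
  choose m hm hmw using fun v => exists_dForm_eq_X_pow h2 ha (hN v)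
  refine exists_contractLeft_eq_of_mem_weightFiltration P.dForm m P.oddDeg hN1 hm (fun v => ?_)
    hp hc hcp
  have h := weightFiltration.ι_mapDomain_mem P.oddDeg id (m v) (hmw v)
  rwa [Finsupp.mapDomain_id] at h

end PureSullivanAlgebra

/-! ### Finite-dimensionality of the cohomology -/

theorem Module.Finite.of_ker_le_ker {A M M₁ M₂ : Type*} [CommRing A] [IsNoetherianRing A]
    [AddCommGroup M] [Module A M] [AddCommGroup M₁] [Module A M₁] [AddCommGroup M₂] [Module A M₂]
    [Module.Finite A M₁] (φ : M →ₗ[A] M₁) (π : M →ₗ[A] M₂) (hπ : Function.Surjective π)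
    (h : LinearMap.ker φ ≤ LinearMap.ker π) : Module.Finite A M₂ := by
  have := Module.Finite.equiv φ.quotKerEquivRange.symm
  refine Module.Finite.of_surjective ((LinearMap.ker φ).liftQ π h) ?_
  rwa [← LinearMap.range_eq_top, Submodule.range_liftQ, LinearMap.range_eq_top]

namespace PureSullivanAlgebra

open MvPolynomial CliffordAlgebra
open scoped Pointwise

universe u

variable {P : PureSullivanAlgebra.{u}}

instance [Finite P.OddGen] : Module.Finite P.EvenAlg P.Alg := by
  classical
  let : LinearOrder P.OddGen := linearOrderOfSTO WellOrderingRel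
  exact Module.Finite.of_basis
    (Finsupp.basisSingleOne (R := P.EvenAlg) (ι := P.OddGen)).ExteriorAlgebra

theorem mem_degreeFiltration_zero (a : P.Alg) : a ∈ P.degreeFiltration 0 := by
  induction a using CliffordAlgebra.left_induction with
  | algebraMap r => exact weightFiltration.algebraMap_mem r
  | add x y hx hy => exact add_mem hx hy
  | ι_mul x m hx =>
    refine weightFiltration.mul_mem (p := 0) (q := 0) ?_ hx
    induction m using Finsupp.induction_linear with
    | zero => rw [map_zero]; exact zero_mem _
    | add f g hf hg => rw [map_add]; exact add_mem hf hg
    | single j f =>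
      rw [← mul_one f, ← smul_eq_mul, ← Finsupp.smul_single, map_smul]
      exact Submodule.smul_mem _ _
        (weightFiltration.antitone (Nat.zero_le _) (weightFiltration.ι_single_mem j))

/-- Each step of the degree filtration has finite codimension. -/
theorem finite_quotient_degreeFiltration [Finite P.EvenGen] [Finite P.OddGen] (p : ℕ) :
    Module.Finite ℚ (P.Alg ⧸ (P.degreeFiltration p).restrictScalars ℚ) := by
  obtain ⟨T, hT⟩ := (Module.Finite.fg_top : (⊤ : Submodule P.EvenAlg P.Alg).FG)
  let D : Set P.EvenAlg := (fun s => monomial s (1 : ℚ)) '' {s | s.degree ≤ p}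
  have hB : (D • (T : Set P.Alg)).Finite :=
    ((Finsupp.finite_of_degree_le p).image _).smul T.finite_toSet
  have hmon : Submodule.span ℚ (Set.range fun s : P.EvenGen →₀ ℕ => monomial s (1 : ℚ)) = ⊤ := by
    have := (basisMonomials P.EvenGen ℚ).span_eq
    rwa [coe_basisMonomials] at this
  have hspan := Submodule.span_smul_of_span_eq_top hmon (T : Set P.Alg)
  rw [hT, Submodule.restrictScalars_top] at hspan
  have htop : (P.degreeFiltration p).restrictScalars ℚ ⊔ Submodule.span ℚ (D • (T : Set P.Alg)) =
      ⊤ := by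
    rw [eq_top_iff, ← hspan, Submodule.span_le]
    rintro _ ⟨_, ⟨s, rfl⟩, t, ht, rfl⟩
    by_cases hs : s.degree ≤ p
    · exact Submodule.mem_sup_right (Submodule.subset_span ⟨_, ⟨s, hs, rfl⟩, t, ht, rfl⟩)
    · refine Submodule.mem_sup_left ?_
      dsimp only
      rw [Submodule.restrictScalars_mem, Algebra.smul_def]
      exact weightFiltration.antitone (by omega)
        (weightFiltration.mul_mem (weightFiltration.monomial_mem s 1) (mem_degreeFiltration_zero t))
  rw [← Submodule.map_mkQ_eq_top] at htop
  exact ⟨htop ▸ (Submodule.fg_span hB).map _⟩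

/-- If all even generators have degree two and are nilpotent modulo the differentials of the odd
ones, then the cohomology is finite-dimensional: cocycles in a step of finite codimension of the
degree filtration are coboundaries. -/
theorem finite_cohomology [Finite P.EvenGen] [Finite P.OddGen] (h2 : ∀ i, P.evenDeg i = 2)
    (hnil : ∀ v, ∃ N, X v ^ N ∈ P.boundaryIdeal) : Module.Finite ℚ P.Cohomology := by
  have := Fintype.ofFinite P.EvenGen
  have := Fintype.ofFinite P.OddGen
  let p := ∑ j, P.oddDeg j + 1
  have := finite_quotient_degreeFiltration (P := P) p
  refine Module.Finite.of_ker_le_ker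
    (((P.degreeFiltration p).restrictScalars ℚ).mkQ ∘ₗ P.cocycles.val.toLinearMap)
    ((Submodule.mkQ P.coboundaries).restrictScalars ℚ)
    (fun c => Quotient.inductionOn' c fun z => ⟨z, rfl⟩) fun z hz => ?_
  have hz' : (z : P.Alg) ∈ P.degreeFiltration p := (Submodule.Quotient.mk_eq_zero _).1 hz
  exact mk_eq_zero_iff.2 (exists_differential_eq_of_mem_degreeFiltration h2 hnil
    (by omega) z.2 hz')

/-- A pure Sullivan algebra on finitely many generators, the even ones of degree two, is elliptic if
and only if all even generators are nilpotent modulo the differentials of the odd ones. -/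
theorem isElliptic_iff [Finite P.EvenGen] [Finite P.OddGen] (h2 : ∀ i, P.evenDeg i = 2) :
    P.IsElliptic ↔ ∀ v, ∃ N, X v ^ N ∈ P.boundaryIdeal := by
  constructor
  · rintro ⟨-, -, h⟩
    have : Module.Finite ℚ P.Cohomology := h
    exact exists_X_pow_mem_boundaryIdeal h2
  · exact fun h => ⟨inferInstance, inferInstance, finite_cohomology h2 h⟩

/-! ### Bounds for the cup-length -/

/-- A power of an even generator outside the ideal of differentials is a non-zero cup product, as
it represents a non-zero class. -/
theorem le_cupLength_of_X_pow_notMem {v : P.EvenGen} {N : ℕ} (hN : X v ^ N ∉ P.boundaryIdeal) :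
    (N : ℕ∞) ≤ P.cupLength := by
  let x : P.cocycles := ⟨P.evenGen v, P.differential_evenGen v⟩
  refine le_sSup ⟨N, fun _ => Ideal.Quotient.mk P.coboundaries x, rfl, fun _ => ?_, ?_⟩
  · refine Submodule.mem_iSup_of_mem (P.evenDeg v - 1) ⟨x, ?_, rfl⟩
    refine Submodule.subset_span ⟨Finsupp.single v 1, [], ?_, ?_⟩
    · have := P.evenDeg_pos v
      simp only [Finsupp.weight_single, List.map_nil, List.sum_nil, smul_eq_mul]
      omega
    · simp only [List.map_nil, List.prod_nil, mul_one]
      rfl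
  · rw [List.ofFn_const, List.prod_replicate, ← map_pow]
    intro h
    obtain ⟨a, ha⟩ := mk_eq_zero_iff.1 h
    refine hN (mem_boundaryIdeal_of_differential_eq (a := a) ?_)
    rw [ha, map_pow]
    rfl

/-- For any positive weights of the odd generators, every positive class is represented by a
cocycle of positive weight. -/
theorem exists_cocycle_mem_weightFiltration {w : P.OddGen → ℕ} (hw : ∀ j, 1 ≤ w j)
    {c : P.Cohomology} (hc : c ∈ P.positiveCohomology) :
    ∃ z : P.cocycles, Ideal.Quotient.mk P.coboundaries z = c ∧
      (z : P.Alg) ∈ weightFiltration ℚ P.EvenGen w 1 := by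
  have hdeg (m : ℕ) :
      P.degreePart (m + 1) ≤ (weightFiltration ℚ P.EvenGen w 1).restrictScalars ℚ := by
    refine Submodule.span_le.2 ?_
    rintro _ ⟨s, l, hsl, rfl⟩
    have hpos (j) : P.oddGen j ∈ weightFiltration ℚ P.EvenGen w 1 :=
      weightFiltration.antitone (hw j) (weightFiltration.ι_single_mem j)
    have hl (l : List P.OddGen) : (l.map P.oddGen).prod ∈ weightFiltration ℚ P.EvenGen w 0 := by
      induction l with
      | nil => simpa using weightFiltration.algebraMap_mem (w := w) 1
      | cons j l ih =>
        rw [List.map_cons, List.prod_cons]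
        exact weightFiltration.mul_mem (p := 0) (q := 0)
          (weightFiltration.antitone (Nat.zero_le 1) (hpos j)) ih
    rw [SetLike.mem_coe, Submodule.restrictScalars_mem]
    cases l with
    | nil =>
      have hs : s ≠ 0 := by
        rintro rfl
        simp at hsl
      have hs' : s.degree ≠ 0 := fun h => hs ((Finsupp.degree_eq_zero_iff s).1 h)
      rw [List.map_nil, List.prod_nil, mul_one]
      exact weightFiltration.antitone (by omega) (weightFiltration.monomial_mem s 1)
    | cons j l =>
      rw [List.map_cons, List.prod_cons]
      exact weightFiltration.mul_mem (p := 0) (q := 1) (weightFiltration.algebraMap_mem _)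
        (weightFiltration.mul_mem (p := 1) (q := 0) (hpos j) (hl l))
  have hle : P.positiveCohomology ≤
      (((weightFiltration ℚ P.EvenGen w 1).restrictScalars ℚ).comap P.cocycles.val.toLinearMap).map
        ((Submodule.mkQ P.coboundaries).restrictScalars ℚ) :=
    iSup_le fun m => Submodule.map_mono (Submodule.comap_mono (hdeg m))
  obtain ⟨z, hz, rfl⟩ := hle hc
  exact ⟨z, rfl, hz⟩

/-- Suppose that every `x_v ^ N` is the differential of an odd element of weight at least `2 N - 1`,
for some positive weights of the odd generators. Then the cup-length is at most the sum of these
weights minus the number of even generators. The weights need not be related to the differential. -/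
theorem cupLength_le [Fintype P.OddGen] [Fintype P.EvenGen] {w : P.OddGen → ℕ}
    (hw : ∀ j, 1 ≤ w j) {N : ℕ} (hN : 1 ≤ N) (m : P.EvenGen → P.OddGen →₀ P.EvenAlg)
    (hm : ∀ v, P.dForm (m v) = X v ^ N)
    (hmw : ∀ v, ExteriorAlgebra.ι _ (m v) ∈ weightFiltration ℚ P.EvenGen w (2 * N - 1)) {D : ℕ}
    (hD : ∑ j, w j ≤ D + Fintype.card P.EvenGen) : P.cupLength ≤ D := by
  refine sSup_le ?_
  rintro _ ⟨M, c, rfl, hc, hne⟩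
  by_contra! hlt
  rw [Nat.cast_lt] at hlt
  have hprod (M : ℕ) (c : Fin M → P.Cohomology) (hc : ∀ i, c i ∈ P.positiveCohomology) :
      ∃ z : P.cocycles, Ideal.Quotient.mk P.coboundaries z = (List.ofFn c).prod ∧
        (z : P.Alg) ∈ weightFiltration ℚ P.EvenGen w M := by
    induction M with
    | zero =>
      exact ⟨1, by simp, by simpa using weightFiltration.algebraMap_mem (w := w) 1⟩
    | succ M ih =>
      obtain ⟨z, hz, hzw⟩ := exists_cocycle_mem_weightFiltration hw (hc 0)
      obtain ⟨z', hz', hzw'⟩ := ih (fun i => c i.succ) fun i => hc _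
      refine ⟨z * z', by rw [map_mul, hz, hz', List.ofFn_succ, List.prod_cons], ?_⟩
      rw [add_comm]
      exact weightFiltration.mul_mem hzw hzw'
  obtain ⟨z, hz, hzw⟩ := hprod M c hc
  exact hne (hz ▸ mk_eq_zero_iff.2 (exists_contractLeft_eq_of_mem_weightFiltration P.dForm m w hN
    hm hmw (by omega) z.2 hzw))

end PureSullivanAlgebra

/-! ### The algebras of a graph -/

section Graph

open MvPolynomial PureSullivanAlgebra

variable {V : Type*}

theorem card_edgeSet_mul_le_dPrime_add [Fintype V] (G : SimpleGraph V) [Fintype G.edgeSet]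
    {k : ℕ} (hk : 2 ≤ k) :
    Fintype.card G.edgeSet * (2 * k - 3) ≤ dPrime (Fintype.card V) k + Fintype.card V := by
  classical
  set n := Fintype.card V with hn
  have hcard : Fintype.card G.edgeSet ≤ n.choose 2 := by
    rw [← SimpleGraph.edgeFinset_card]
    exact SimpleGraph.card_edgeFinset_le_card_choose_two
  have hceil : ((n : ℚ) * (n - 1) * (2 * k - 3) - n) / 2 ≤ dPrime n k := Nat.le_ceil _
  have hk' : ((2 * k - 3 : ℕ) : ℚ) = 2 * k - 3 := by
    rw [Nat.cast_sub (by omega)]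
    push_cast
    ring
  have hmul : ((Fintype.card G.edgeSet * (2 * k - 3) : ℕ) : ℚ) ≤
      (n : ℚ) * (n - 1) / 2 * (2 * k - 3) := by
    rw [Nat.cast_mul, hk', ← Nat.cast_choose_two]
    exact mul_le_mul_of_nonneg_right (by exact_mod_cast hcard) (hk' ▸ Nat.cast_nonneg _)
  have hn0 : (0 : ℚ) ≤ n := Nat.cast_nonneg n
  rw [← Nat.cast_le (α := ℚ)]
  push_cast at hmul ⊢
  linarith

/-- The additional generators of `ΛW` do not matter in low degrees: their differentials have
polynomial degree `2 (d' + n + 1)`. -/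
theorem X_pow_mem_boundaryIdeal_of_extended [Fintype V] (G : SimpleGraph V) {k : ℕ} (hk : 2 ≤ k)
    {v : V} {D : ℕ} (hD : D < 2 * (dPrime (Fintype.card V) k + Fintype.card V + 1))
    (h : (X v : MvPolynomial V ℚ) ^ D ∈ (extendedGraphAlgebra G k hk).boundaryIdeal) :
    (X v : MvPolynomial V ℚ) ^ D ∈ (graphAlgebra G k hk).boundaryIdeal := by
  let a : G.edgeSet ⊕ V → ℕ := Sum.elim (fun _ => k - 1)
    fun _ => 2 * (dPrime (Fintype.card V) k + Fintype.card V + 1)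
  have ha (j) : (extendedGraphAlgebra G k hk).oddDeg j + 1 = 2 * a j := by
    rcases j with e | v
    · show 2 * k - 3 + 1 = 2 * (k - 1)
      omega
    · show 4 * (dPrime (Fintype.card V) k + Fintype.card V) + 3 + 1 =
        2 * (2 * (dPrime (Fintype.card V) k + Fintype.card V + 1))
      ring
  obtain ⟨g, hg⟩ := mem_boundaryIdeal_iff.1 h
  obtain ⟨g', -, hg0, hg'⟩ := exists_homogeneousComponent_eq_linearCombination
    (isHomogeneous_dOdd (P := extendedGraphAlgebra G k hk) (fun _ => rfl) ha) D g
  have hX : homogeneousComponent D ((X v : MvPolynomial V ℚ) ^ D) = X v ^ D :=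
    homogeneousComponent_eq_self (isHomogeneous_X_pow v D)
  rw [← hX, ← hg]
  refine (congrArg (· ∈ (graphAlgebra G k hk).boundaryIdeal) hg').mpr ?_
  rw [Finsupp.linearCombination_apply]
  refine Submodule.sum_mem _ fun j hj => ?_
  rcases j with e | v
  · exact Submodule.smul_mem _ _ (Ideal.subset_span ⟨e, rfl⟩)
  · exact absurd (hg0 (Sum.inr v) hD) (Finsupp.mem_support_iff.1 hj)

/-- If the even generators are nilpotent modulo the differentials in `ΛV`, then `ΛW` has cup-length
at most `d' + n`: give the generators `z_v` weight one and the `y_e` their degree. -/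
theorem cupLength_extendedGraphAlgebra_le [Fintype V] (G : SimpleGraph V) {k : ℕ} (hk : 2 ≤ k)
    (hnil : ∀ v : V, ∃ N, (X v : MvPolynomial V ℚ) ^ N ∈ (graphAlgebra G k hk).boundaryIdeal) :
    (extendedGraphAlgebra G k hk).cupLength ≤
      (dPrime (Fintype.card V) k + Fintype.card V : ℕ) := by
  have := Classical.decRel G.Adj
  have : Finite (graphAlgebra G k hk).EvenGen := inferInstanceAs (Finite V)
  let : Fintype (extendedGraphAlgebra G k hk).EvenGen := ‹Fintype V›
  let : Fintype (extendedGraphAlgebra G k hk).OddGen := inferInstanceAs (Fintype (G.edgeSet ⊕ V))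
  obtain ⟨N, hN1, hN⟩ := exists_forall_X_pow_mem_boundaryIdeal (P := graphAlgebra G k hk) hnil
  choose m hm hmw using fun v => exists_dForm_eq_X_pow (P := graphAlgebra G k hk)
    (fun _ => rfl) (a := fun _ => k - 1) (fun j => show 2 * k - 3 + 1 = 2 * (k - 1) by omega)
    (hN v)
  let w : G.edgeSet ⊕ V → ℕ := Sum.elim (fun _ => 2 * k - 3) fun _ => 1
  have hw (j) : 1 ≤ w j := by
    rcases j with e | v
    · show 1 ≤ 2 * k - 3
      omega
    · exact le_rfl
  refine cupLength_le (P := extendedGraphAlgebra G k hk) (w := w) hw hN1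
    (fun v => (m v).mapDomain Sum.inl) (fun v => ?_)
    (fun v => weightFiltration.ι_mapDomain_mem w Sum.inl (m v) (hmw v)) ?_
  · exact (Finsupp.linearCombination_mapDomain _ _ _).trans (hm v)
  · refine (Fintype.sum_sum_type w).trans_le ?_
    have hE := card_edgeSet_mul_le_dPrime_add G hk
    simp only [w, Sum.elim_inl, Sum.elim_inr, Finset.sum_const, Finset.card_univ, smul_eq_mul,
      mul_one]
    exact Nat.add_le_add_right hE _

end Graph

theorem proposition1 {V : Type*} [Fintype V] (G : SimpleGraph V) (hG : G.Connected)
    (n k : ℕ) (hV : Fintype.card V = n) (hn : 1 ≤ n) (hk : 2 ≤ k) :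
    (extendedGraphAlgebra G k hk).cupLength ≤ ((dPrime n k + n : ℕ) : ℕ∞) ↔
      (graphAlgebra G k hk).IsElliptic := by
  subst hV
  have : Finite (graphAlgebra G k hk).EvenGen := inferInstanceAs (Finite V)
  have : Finite (graphAlgebra G k hk).OddGen := inferInstanceAs (Finite G.edgeSet)
  rw [PureSullivanAlgebra.isElliptic_iff (P := graphAlgebra G k hk) fun _ => rfl]
  refine ⟨fun h => ?_, cupLength_extendedGraphAlgebra_le G hk⟩
  by_contra! hnot
  obtain ⟨v, hv⟩ := hnot
  have hlt := (PureSullivanAlgebra.le_cupLength_of_X_pow_notMem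
    (P := extendedGraphAlgebra G k hk) (v := v) fun hmem =>
    hv (dPrime (Fintype.card V) k + Fintype.card V + 1)
      (X_pow_mem_boundaryIdeal_of_extended G hk (by omega) hmem)).trans h
  rw [Nat.cast_le] at hlt
  omega
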